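/- Let $1\le l\le d$ be integers. For $x\in[0,\infty]^d$ write $x=(x^1,\dots,x^d)$ and let $x^{(l)}$ be the $l$-th largest of its components. Put $\mathbb E^{(l)}=\{x\in[0,\infty]^d: x^{(l)}>0\}$, $\aleph^{(l)}=\{x: x^{(l)}\ge 1\}$ and $\delta\aleph^{(l)}=\{x: x^{(l)}=1\}$. For a locally compact space $\mathbb F$ with countable base, let $M_+(\mathbb F)$ be the space of non-negative Radon measures on $\mathbb F$ with the vague topology, and let $\Rightarrow$ denote weak convergence of random elements of $M_+(\mathbb F)$. Let $\alpha^{(l)}>0$ and let $\nu^{(l)}\in M_+(\mathbb E^{(l)})$ satisfy the scaling property $\nu^{(l)}(cA)=c^{-\alpha^{(l)}}\nu^{(l)}(A)$ for all $c>0$ and all Borel sets $A\subset\mathbb E^{(l)}$, and $\nu^{(l)}(\aleph^{(l)})=1$, as a normalized limit measure of hidden regular variation on $\mathbb E^{(l)}$ does. Let $\nu_{\alpha^{(l)}}$ be the Pareto measure $\alpha^{(l)}r^{-\alpha^{(l)}-1}\,dr$ on $(0,\infty]$ (without mass at $\infty$), and let $S^{(l)}$ be the hidden angular measure of $\nu^{(l)}$,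 i.e. the probability measure on $\delta\aleph^{(l)}$ determined by $$\nu^{(l)}\Big(\Big\{x\in\mathbb E^{(l)}: x^{(l)}\ge r,\ \frac{x}{x^{(l)}}\in\Lambda\Big\}\Big)=r^{-\alpha^{(l)}}S^{(l)}(\Lambda)\qquad(r>0,\ \Lambda\subset\delta\aleph^{(l)}\text{ Borel}),$$ equivalently by the case $r=1$ of this relation. Let $Z_1,Z_2,\dots$ be random vectors in $[0,\infty)^d$ on a common probability space. For each $n$ and $1\le i\le n$, $1\le j\le d$, let $r_i^j=\#\{p\le n: Z_p^j\ge Z_i^j\}$ be the anti-ranks in the sample $Z_1,\dots,Z_n$, let $m_i^{(l)}$ be the $l$-th largest of the numbers $1/r_i^j$, $1\le j\le d$, and let $m_{(1)}^{(l)}\ge\dots\ge m_{(n)}^{(l)}$ be the numbers $m_1^{(l)},\dots,m_n^{(l)}$ in decreasing order. Let $k=k(n)$ be positive integers with $k(n)\to\infty$ and $k(n)/n\to0$ as $n\to\infty$. Write $\epsilon_x$ for the unit point mass at $x$. Then the following two statements are equivalent, as $n\to\infty$: 1. $\displaystyle \hat\nu^{(l)}:=\frac1k\sum_{i=1}^n\epsilon_{\left((1/r_i^j)/m_{(k)}^{(l)},\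 1\le j\le d\right)}\Rightarrow\nu^{(l)}$ on $M_+(\mathbb E^{(l)})$; 2. $\displaystyle \frac1k\sum_{i=1}^n\epsilon_{\left(m_i^{(l)}/m_{(k)}^{(l)},\ \left((1/r_i^j)/m_i^{(l)},\ 1\le j\le d\right)\right)}\Rightarrow\nu_{\alpha^{(l)}}\times S^{(l)}$ on $M_+((0,\infty]\times\delta\aleph^{(l)})$. -/

import Mathlib

open MeasureTheory Filter Topology Set
open scoped ENNReal NNReal CompactlySupported

noncomputable section

namespace HRV

/-! ### Random Radon measures -/

/-- `M_+(E)`: the non-negative Radon measures on `E`. On a locally compact space with a countable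
base (all the spaces below are of this kind) a Borel measure is Radon as soon as it is finite on
compact sets. -/
def RadonMeasure (E : Type*) [TopologicalSpace E] [MeasurableSpace E] : Type _ :=
  {μ : Measure E // IsFiniteMeasureOnCompacts μ}

/-- The vague topology on `M_+(E)`: the coarsest topology for which `μ ↦ ∫ f dμ` is continuous for
every non-negative continuous function `f` with compact support. -/
instance {E : Type*} [TopologicalSpace E] [MeasurableSpace E] :
    TopologicalSpace (RadonMeasure E) :=
  TopologicalSpace.induced (fun μ (f : C_c(E, ℝ≥0)) => ∫⁻ x, (f x : ℝ≥0∞) ∂μ.1) inferInstance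

/-- `M_+(E)` carries the Borel σ-algebra of the vague topology. -/
instance {E : Type*} [TopologicalSpace E] [MeasurableSpace E] :
    MeasurableSpace (RadonMeasure E) :=
  borel (RadonMeasure E)

instance {E : Type*} [TopologicalSpace E] [MeasurableSpace E] : BorelSpace (RadonMeasure E) :=
  ⟨rfl⟩

/-- Weak convergence `ξ n ⇒ m` in `M_+(E)`, as `n → ∞`, of a sequence of random measures on a
probability space `(Ω, P)` to a non-random measure `m`. -/
def WeakTendsto {Ω : Type*} [MeasurableSpace Ω] (P : Measure Ω) [IsProbabilityMeasure P]
    {E : Type*} [TopologicalSpace E] [MeasurableSpace E]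
    (ξ : ℕ → Ω → RadonMeasure E) (m : RadonMeasure E) : Prop :=
  TendstoInDistribution ξ atTop (fun _ : Ω => m) (fun _ => P) P

open Classical in
/-- The unit point mass `ε_x`, as a measure on the subset `s` of `X` (zero if `x ∉ s`). -/
def pointMass {X : Type*} [MeasurableSpace X] (s : Set X) (x : X) : Measure s :=
  if h : x ∈ s then Measure.dirac ⟨x, h⟩ else 0

instance {X : Type*} [MeasurableSpace X] (s : Set X) (x : X) : IsFiniteMeasure (pointMass s x) := by
  unfold pointMass
  split_ifs <;> infer_instance

/-! ### Order statistics and cones -/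

/-- The `k`-th largest among the numbers `x 0, …, x (n - 1)`, for `1 ≤ k ≤ n`: the maximum, over
all sets of `k` indices, of the least of the corresponding numbers. -/
def kthLargest {n : ℕ} (k : ℕ) (x : Fin n → ℝ≥0∞) : ℝ≥0∞ :=
  (Finset.univ.powersetCard k).sup fun s => s.inf x

/-- `x^{(k)} ≥ t` if and only if at least `k` of the numbers are `≥ t`. -/
theorem le_kthLargest_iff {n k : ℕ} (hk : k ≤ n) (x : Fin n → ℝ≥0∞) (t : ℝ≥0∞) :
    t ≤ kthLargest k x ↔ k ≤ (Finset.univ.filter fun i => t ≤ x i).card := by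
  unfold kthLargest
  have hne : (Finset.powersetCard k (Finset.univ : Finset (Fin n))).Nonempty := by
    rw [Finset.powersetCard_nonempty]; simpa using hk
  constructor
  · intro h
    obtain ⟨s, hs, hs'⟩ := Finset.exists_mem_eq_sup _ hne fun s => s.inf x
    rw [hs'] at h
    rw [← (Finset.mem_powersetCard.1 hs).2]
    exact Finset.card_le_card fun i hi => by
      simpa using h.trans (Finset.inf_le hi)
  · intro h
    obtain ⟨s, hs, hs'⟩ := Finset.exists_subset_card_eq h
    refine le_trans (Finset.le_inf fun i hi => ?_)
      (Finset.le_sup (f := fun s : Finset (Fin n) => s.inf x)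
        (Finset.mem_powersetCard.2 ⟨Finset.subset_univ s, hs'⟩))
    simpa using hs hi

theorem continuous_kthLargest {n : ℕ} (k : ℕ) :
    Continuous (kthLargest k : (Fin n → ℝ≥0∞) → ℝ≥0∞) := by
  unfold kthLargest
  exact Continuous.finset_sup_apply fun s _ =>
    Continuous.finset_inf_apply fun i _ => continuous_apply i

/-- The cone `𝔼^{(l)} = {x ∈ [0, ∞]^d : x^{(l)} > 0}`. -/
def cone (d l : ℕ) : Set (Fin d → ℝ≥0∞) := {x | 0 < kthLargest l x}

/-- The set `δℵ^{(l)} = {x ∈ 𝔼^{(l)} : x^{(l)} = 1}`. -/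
def deltaAleph (d l : ℕ) : Set (Fin d → ℝ≥0∞) := {x | kthLargest l x = 1}

theorem measurableSet_deltaAleph (d l : ℕ) : MeasurableSet (deltaAleph d l) :=
  (continuous_kthLargest l).measurable (measurableSet_singleton 1)

/-- `ℵ^{(l)} = {x ∈ 𝔼^{(l)} : x^{(l)} ≥ 1}`, as a subset of `𝔼^{(l)}`. -/
def aleph (d l : ℕ) : Set (cone d l) := {x | 1 ≤ kthLargest l x.1}

theorem isCompact_aleph (d l : ℕ) : IsCompact (aleph d l) := by
  rw [Subtype.isCompact_iff]
  have : (Subtype.val '' aleph d l : Set (Fin d → ℝ≥0∞)) = {x | 1 ≤ kthLargest l x} := by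
    ext x
    constructor
    · rintro ⟨y, hy, rfl⟩
      exact hy
    · intro hx
      exact ⟨⟨x, lt_of_lt_of_le (zero_lt_one' ℝ≥0∞) hx⟩, hx, rfl⟩
  rw [this]
  exact (isClosed_le continuous_const (continuous_kthLargest l)).isCompact

/-- The componentwise quotient `x / x^{(l)}`. -/
def angle {d : ℕ} (l : ℕ) (x : Fin d → ℝ≥0∞) : Fin d → ℝ≥0∞ := fun j => x j / kthLargest l x

theorem measurable_angle {d : ℕ} (l : ℕ) : Measurable (angle (d := d) l) :=
  measurable_pi_lambda _ fun j =>
    (measurable_pi_apply j).div (continuous_kthLargest l).measurable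

/-! ### The limit measures -/

/-- The scaling property `ν (c A) = c ^ (-α) ν (A)`, `c > 0`, `A` a Borel set, of a measure on
`𝔼^{(l)}`. -/
def Scaling {d l : ℕ} (α : ℝ) (ν : Measure (cone d l)) : Prop :=
  ∀ c : ℝ≥0, 0 < c → ∀ A : Set (Fin d → ℝ≥0∞), MeasurableSet A →
    ν {x | x.1 ∈ (fun a => c • a) '' A} = (c : ℝ≥0∞) ^ (-α) * ν {x | x.1 ∈ A}

/-- The (hidden) angular measure on `δℵ^{(l)}` of a measure `ν` on `𝔼^{(l)}`:
`S (Λ) = ν {x : x^{(l)} ≥ 1, x / x^{(l)} ∈ Λ}`. -/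
def angularMeasure {d l : ℕ} (ν : Measure (cone d l)) : Measure (deltaAleph d l) :=
  ((ν.restrict (aleph d l)).map fun x => angle l x.1).comap Subtype.val

theorem angularMeasure_apply {d l : ℕ} (ν : Measure (cone d l)) {Λ : Set (deltaAleph d l)}
    (hΛ : MeasurableSet Λ) :
    angularMeasure ν Λ = ν {x | 1 ≤ kthLargest l x.1 ∧ angle l x.1 ∈ Subtype.val '' Λ} := by
  have h1 : MeasurableSet (Subtype.val '' Λ : Set (Fin d → ℝ≥0∞)) :=
    (measurableSet_deltaAleph d l).subtype_image hΛ
  have h2 : Measurable fun x : cone d l => angle l x.1 :=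
    (measurable_angle l).comp measurable_subtype_coe
  rw [angularMeasure, comap_subtype_coe_apply (measurableSet_deltaAleph d l),
    Measure.map_apply h2 h1, Measure.restrict_apply (h2 h1), inter_comm]
  rfl

theorem isFiniteMeasure_angularMeasure {d l : ℕ} (ν : RadonMeasure (cone d l)) :
    IsFiniteMeasure (angularMeasure ν.1) := by
  have := ν.2
  refine ⟨?_⟩
  rw [angularMeasure_apply _ MeasurableSet.univ]
  exact lt_of_le_of_lt (measure_mono fun x hx => hx.1) (isCompact_aleph d l).measure_lt_top

theorem kthLargest_smul {n : ℕ} (k : ℕ) {c : ℝ≥0} (hc : 0 < c) (x : Fin n → ℝ≥0∞) :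
    kthLargest k (c • x) = c * kthLargest k x := by
  have hm : Monotone fun t : ℝ≥0∞ => (c : ℝ≥0∞) * t := fun a b h => mul_le_mul_right h _
  unfold kthLargest
  rw [Finset.apply_sup_eq_sup_comp_of_linearOrder _ hm (by simp)]
  refine Finset.sup_congr rfl fun s _ => ?_
  simp only [Function.comp_apply]
  rw [Finset.apply_inf_eq_inf_comp_of_linearOrder _ hm (by simp [hc.ne'])]
  rfl

theorem angle_smul {d : ℕ} (l : ℕ) {c : ℝ≥0} (hc : 0 < c) (x : Fin d → ℝ≥0∞) :
    angle l (c • x) = angle l x := by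
  funext j
  simp only [angle, kthLargest_smul l hc]
  exact ENNReal.mul_div_mul_left _ _ (by simpa using hc.ne') (by simp)

/-- The polar decomposition that determines the angular measure:
`ν {x : x^{(l)} ≥ r, x / x^{(l)} ∈ Λ} = r ^ (-α) S (Λ)` for all `r > 0`. -/
theorem Scaling.polar {d l : ℕ} {α : ℝ} {ν : Measure (cone d l)} (h : Scaling α ν) {r : ℝ≥0}
    (hr : 0 < r) {Λ : Set (deltaAleph d l)} (hΛ : MeasurableSet Λ) :
    ν {x | r ≤ kthLargest l x.1 ∧ angle l x.1 ∈ Subtype.val '' Λ} =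
      (r : ℝ≥0∞) ^ (-α) * angularMeasure ν Λ := by
  have h1 : MeasurableSet (Subtype.val '' Λ : Set (Fin d → ℝ≥0∞)) :=
    (measurableSet_deltaAleph d l).subtype_image hΛ
  have hr0 : (r : ℝ≥0∞) ≠ 0 := by simpa using hr.ne'
  rw [angularMeasure_apply ν hΛ]
  refine Eq.trans ?_ (h r hr
    {x | 1 ≤ kthLargest l x ∧ angle l x ∈ (Subtype.val '' Λ : Set (Fin d → ℝ≥0∞))}
    (((continuous_kthLargest l).measurable measurableSet_Ici).inter (measurable_angle l h1)))
  congr 1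
  ext x
  constructor
  · rintro ⟨hx1, hx2⟩
    have hx : x.1 = r • (r⁻¹ • x.1) := by rw [smul_smul, mul_inv_cancel₀ hr.ne', one_smul]
    refine ⟨r⁻¹ • x.1, ⟨?_, ?_⟩, hx.symm⟩
    · rw [kthLargest_smul l (inv_pos.2 hr), ENNReal.coe_inv hr.ne', mul_comm, ← div_eq_mul_inv,
        ENNReal.le_div_iff_mul_le (Or.inl hr0) (Or.inl (by simp)), one_mul]
      exact hx1
    · rwa [angle_smul l (inv_pos.2 hr)]
  · rintro ⟨a, ⟨ha1, ha2⟩, hax⟩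
    simp only [mem_ofPred_eq, ← hax]
    rw [kthLargest_smul l hr, angle_smul l hr]
    exact ⟨le_mul_of_one_le_right zero_le ha1, ha2⟩

/-- The Pareto measure `ν_α (dr) = α r ^ (-α - 1) dr` on `(0, ∞]`, without mass at `∞`. -/
def pareto (α : ℝ) : Measure (Ioi (0 : ℝ≥0∞)) :=
  (((volume.restrict (Ioi (0 : ℝ))).withDensity
    fun r => ENNReal.ofReal (α * r ^ (-α - 1))).map ENNReal.ofReal).comap Subtype.val

theorem pareto_Ici {α : ℝ} (hα : 0 < α) {r : ℝ} (hr : 0 < r) :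
    pareto α {x | ENNReal.ofReal r ≤ x.1} = ENNReal.ofReal (r ^ (-α)) := by
  have himg : (Subtype.val '' {x : Ioi (0 : ℝ≥0∞) | ENNReal.ofReal r ≤ x.1} : Set ℝ≥0∞)
      = Ici (ENNReal.ofReal r) := by
    ext x
    constructor
    · rintro ⟨y, hy, rfl⟩
      exact hy
    · intro hx
      exact ⟨⟨x, lt_of_lt_of_le (ENNReal.ofReal_pos.2 hr) hx⟩, hx, rfl⟩
  have hpre : ENNReal.ofReal ⁻¹' Ici (ENNReal.ofReal r) = Ici r := by
    ext x
    simp only [mem_preimage, mem_Ici]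
    constructor
    · intro h
      by_contra hx
      exact absurd h (not_le.2 ((ENNReal.ofReal_lt_ofReal_iff hr).2 (not_le.1 hx)))
    · exact ENNReal.ofReal_le_ofReal
  rw [pareto, comap_subtype_coe_apply measurableSet_Ioi, himg,
    Measure.map_apply ENNReal.measurable_ofReal measurableSet_Ici, hpre,
    withDensity_apply _ measurableSet_Ici, Measure.restrict_restrict measurableSet_Ici,
    inter_eq_left.2 (show Ici r ⊆ Ioi 0 from fun x hx => lt_of_lt_of_le hr hx), ← restrict_Ioi_eq_restrict_Ici,
    ← ofReal_integral_eq_lintegral_ofReal]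
  · rw [integral_const_mul, integral_Ioi_rpow_of_lt (by linarith) hr]
    congr 1
    have : -α - 1 + 1 = -α := by ring
    rw [this]
    field_simp
  · exact (integrableOn_Ioi_rpow_of_lt (by linarith) hr).const_mul α
  · refine (ae_restrict_iff' measurableSet_Ioi).2 (Eventually.of_forall fun x hx => ?_)
    have : 0 < x := lt_trans hr hx
    positivity

/-- The product measure `ν_α × S` on `(0, ∞] × δℵ^{(l)}`, with `S` the angular measure of `ν`. -/
def polarLimit {d l : ℕ} {α : ℝ} (hα : 0 < α) (ν : RadonMeasure (cone d l)) :
    RadonMeasure (Ioi (0 : ℝ≥0∞) × deltaAleph d l) :=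
  ⟨(pareto α).prod (angularMeasure ν.1), by
    have := isFiniteMeasure_angularMeasure ν
    refine ⟨fun K hK => ?_⟩
    have hK1 : IsCompact ((fun p : Ioi (0 : ℝ≥0∞) × deltaAleph d l => p.1.1) '' K) :=
      hK.image (by fun_prop)
    obtain ⟨r, hr, hrK⟩ : ∃ r : ℝ, 0 < r ∧ ∀ p ∈ K, ENNReal.ofReal r ≤ p.1.1 := by
      rcases K.eq_empty_or_nonempty with rfl | hne
      · exact ⟨1, one_pos, by simp⟩
      · obtain ⟨_, ⟨q, hq, rfl⟩, hmin⟩ := hK1.exists_isLeast (hne.image _)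
        obtain ⟨r, hr0, hr⟩ := ENNReal.lt_iff_exists_nnreal_btwn.1 (show 0 < q.1.1 from q.1.2)
        refine ⟨r, by simpa using hr0, fun p hp => ?_⟩
        rw [ENNReal.ofReal_coe_nnreal]
        exact hr.le.trans (hmin ⟨p, hp, rfl⟩)
    calc (pareto α).prod (angularMeasure ν.1) K
        ≤ (pareto α).prod (angularMeasure ν.1) ({x | ENNReal.ofReal r ≤ x.1} ×ˢ univ) :=
          measure_mono fun p hp => ⟨hrK p hp, mem_univ _⟩
      _ = pareto α {x | ENNReal.ofReal r ≤ x.1} * angularMeasure ν.1 univ :=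
          Measure.prod_prod _ _
      _ < ∞ := by
          rw [pareto_Ici hα hr]
          exact ENNReal.mul_lt_top ENNReal.ofReal_lt_top (measure_lt_top _ _)⟩

/-! ### The rank-based empirical measures -/

/-- The anti-rank `r_i^j`: the number of the `n` vectors whose `j`-th component is at least that of
the `i`-th vector. -/
def antiRank {n d : ℕ} (z : Fin n → Fin d → ℝ≥0) (i : Fin n) (j : Fin d) : ℕ :=
  (Finset.univ.filter fun p => z i j ≤ z p j).card

/-- The vector `(1 / r_i^j, 1 ≤ j ≤ d)`. -/
def invRank {n d : ℕ} (z : Fin n → Fin d → ℝ≥0) (i : Fin n) : Fin d → ℝ≥0∞ :=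
  fun j => 1 / (antiRank z i j : ℝ≥0∞)

/-- `m_i^{(l)}`: the `l`-th largest among `1 / r_i^j`, `1 ≤ j ≤ d`. -/
def rankMax {n d : ℕ} (l : ℕ) (z : Fin n → Fin d → ℝ≥0) (i : Fin n) : ℝ≥0∞ :=
  kthLargest l (invRank z i)

/-- `m_{(k)}^{(l)}`: the `k`-th largest among `m_1^{(l)}, …, m_n^{(l)}`. -/
def rankMaxOrd {n d : ℕ} (l k : ℕ) (z : Fin n → Fin d → ℝ≥0) : ℝ≥0∞ :=
  kthLargest k (rankMax l z)

/-- `ν̂^{(l)} = (1 / k) ∑_i ε_{((1 / r_i^j) / m_{(k)}^{(l)}, 1 ≤ j ≤ d)}`, a measure on `𝔼^{(l)}`. -/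
def rankEmpirical {n d : ℕ} (l k : ℕ) (z : Fin n → Fin d → ℝ≥0) : RadonMeasure (cone d l) :=
  ⟨(k : ℝ≥0)⁻¹ • ∑ i, pointMass (cone d l) (fun j => invRank z i j / rankMaxOrd l k z),
    inferInstance⟩

/-- `(1 / k) ∑_i ε_{(m_i^{(l)} / m_{(k)}^{(l)}, ((1 / r_i^j) / m_i^{(l)}, 1 ≤ j ≤ d))}`, a measure on
`(0, ∞] × δℵ^{(l)}`; the point mass at a pair is written as a product of point masses. -/
def rankPolarEmpirical {n d : ℕ} (l k : ℕ) (z : Fin n → Fin d → ℝ≥0) :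
    RadonMeasure (Ioi (0 : ℝ≥0∞) × deltaAleph d l) :=
  ⟨(k : ℝ≥0)⁻¹ • ∑ i, (pointMass (Ioi 0) (rankMax l z i / rankMaxOrd l k z)).prod
      (pointMass (deltaAleph d l) (fun j => invRank z i j / rankMax l z i)),
    inferInstance⟩

end HRV

end

/-! The polar map `toPolar`, x ↦ (x^{(l)}, x / x^{(l)}), carries the rank empirical measure to its
polar version for each sample with 1 ≤ k ≤ n, and carries ν to ν_α × S. The equivalence therefore
amounts to vague continuity, at the limits, of push-forward under `toPolar` and under its inverse
`ofPolar`.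

Randomness is removed first. Both limits are constant, so weak convergence is convergence in
probability, which is convergence along a filter on ℕ × Ω (`tendstoInDistribution_const_iff`). Both
directions then follow from one deterministic mapping theorem, `tendsto_map_of_height`.

The difficulty is at infinite height. The points with x^{(l)} = ∞ belong to the cone and make the
level sets {x^{(l)} ≥ r} compact, but there the angle may involve ∞/∞ and the inverse ∞·0, so
neither map need be continuous. The limits do not charge these points: scaling maps {x^{(l)} = ∞} to
itself, while it multiplies the finite measure of that set by c^{-α}. Test functions can thus be cut
off at large heights, and the error is dominated by a multiple of a function that is again
continuous with compact support. The ranks matter only through 1 ≤ r_i^j ≤ n, which keeps all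
heights positive and finite. -/

namespace HRV

/-! ### Convergence in probability as convergence along a filter -/

/-- The filter on `ℕ × Ω` of the sets whose `n`-th section has probability tending to one: a
sequence of random elements converges in probability to a constant if and only if it converges
along this filter. -/
def inProbability {Ω : Type*} [MeasurableSpace Ω] (P : Measure Ω) : Filter (ℕ × Ω) where
  sets := {A | Tendsto (fun n => P {ω | (n, ω) ∉ A}) atTop (𝓝 0)}
  univ_sets := by simp
  sets_of_superset {A B} hA hAB := by
    refine tendsto_of_tendsto_of_tendsto_of_le_of_le tendsto_const_nhds hA (fun _ => zero_le)
      fun n => measure_mono fun ω hω h => hω (hAB h)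
  inter_sets {A B} hA hB := by
    have h := Tendsto.add (mem_ofPred_eq ▸ hA) hB
    rw [add_zero] at h
    refine tendsto_of_tendsto_of_tendsto_of_le_of_le tendsto_const_nhds h (fun _ => zero_le)
      fun n => le_trans (measure_mono fun ω hω => ?_) (measure_union_le _ _)
    by_contra hc
    simp only [mem_union, mem_ofPred_eq, not_or, not_not] at hc
    exact hω hc

theorem eventually_inProbability_iff {Ω : Type*} [MeasurableSpace Ω] {P : Measure Ω}
    {p : ℕ × Ω → Prop} :
    (∀ᶠ a in inProbability P, p a) ↔ Tendsto (fun n => P {ω | ¬ p (n, ω)}) atTop (𝓝 0) :=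
  Iff.rfl

theorem eventually_inProbability_of_forall {Ω : Type*} [MeasurableSpace Ω] {P : Measure Ω}
    {p : ℕ × Ω → Prop} (h : ∀ᶠ n in atTop, ∀ ω, p (n, ω)) : ∀ᶠ a in inProbability P, p a := by
  rw [eventually_inProbability_iff]
  refine tendsto_const_nhds.congr' (h.mono fun n hn => ?_)
  simp [hn]

/-- Convergence in distribution to a constant is convergence in probability, in a completely
regular space. -/
theorem tendstoInDistribution_const_iff {Ω : Type*} [MeasurableSpace Ω] (P : Measure Ω)
    [IsProbabilityMeasure P] {E : Type*} [TopologicalSpace E] [CompletelyRegularSpace E]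
    [MeasurableSpace E] [BorelSpace E] {ξ : ℕ → Ω → E} (hξ : ∀ n, Measurable (ξ n)) (m : E) :
    TendstoInDistribution ξ atTop (fun _ : Ω => m) (fun _ => P) P ↔
      Tendsto (fun a : ℕ × Ω => ξ a.1 a.2) (inProbability P) (𝓝 m) := by
  constructor
  · intro h
    have h1 := ProbabilityMeasure.tendsto_iff_forall_lintegral_tendsto.1 h.tendsto
    intro U hU
    obtain ⟨V, hVU, hV, hmV⟩ := mem_nhds_iff.1 hU
    -- A bounded continuous function that is 0 at m and 1 off V. Its expectations tend to 0, and
    -- Markov's inequality bounds the probability of leaving V.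
    obtain ⟨f, hf, hfm, hfV⟩ := CompletelyRegularSpace.completely_regular m Vᶜ hV.isClosed_compl
      (by simpa using hmV)
    let g : BoundedContinuousFunction E ℝ≥0 :=
      BoundedContinuousFunction.mkOfBound
        ⟨fun x => ⟨(f x : ℝ), (f x).2.1⟩, by fun_prop⟩ 1 (by
          intro x y
          rw [NNReal.dist_eq]
          have h1 := (f x).2
          have h2 := (f y).2
          change |((f x : unitInterval) : ℝ) - f y| ≤ 1
          exact abs_sub_le_iff.2 ⟨by linarith [h1.2, h2.1], by linarith [h1.1, h2.2]⟩)
    have hgm : g m = 0 := by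
      apply NNReal.eq
      change ((f m : unitInterval) : ℝ) = 0
      simp [hfm]
    have hgV : ∀ x, x ∉ V → g x = 1 := fun x hx => by
      apply NNReal.eq
      change ((f x : unitInterval) : ℝ) = 1
      simp [hfV (show x ∈ Vᶜ from hx)]
    have hgmeas : Measurable fun x => (g x : ℝ≥0∞) := by
      exact (ENNReal.continuous_coe.comp g.continuous).measurable
    have h2 := h1 g
    simp only [ProbabilityMeasure.coe_mk] at h2
    rw [lintegral_map hgmeas measurable_const] at h2
    simp only [hgm, ENNReal.coe_zero, lintegral_zero] at h2
    refine tendsto_of_tendsto_of_tendsto_of_le_of_le tendsto_const_nhds h2 (fun _ => zero_le)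
      fun n => ?_
    dsimp only
    rw [lintegral_map hgmeas (hξ n)]
    calc P {ω | (n, ω) ∉ (fun a : ℕ × Ω => ξ a.1 a.2) ⁻¹' U}
        ≤ P {ω | 1 ≤ (g (ξ n ω) : ℝ≥0∞)} := measure_mono fun ω hω => by
          have : ξ n ω ∉ V := fun h => hω (hVU h)
          simp [hgV _ this]
      _ ≤ ∫⁻ ω, g (ξ n ω) ∂P := by
          simpa using mul_meas_ge_le_lintegral (μ := P) (hgmeas.comp (hξ n)) 1
  · intro h
    refine ⟨fun n => (hξ n).aemeasurable, aemeasurable_const, ?_⟩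
    -- Portmanteau criterion on open sets: the limit law of G is 0 or 1, and only the case m ∈ G has
    -- content.
    refine tendsto_of_forall_isOpen_le_liminf' fun G hG => ?_
    simp only [ProbabilityMeasure.coe_mk]
    rw [Measure.map_apply measurable_const hG.measurableSet]
    by_cases hm : m ∈ G
    · have h1 : Tendsto (fun n => P (ξ n ⁻¹' G)ᶜ) atTop (𝓝 0) := h (hG.mem_nhds hm)
      have h2 : Tendsto (fun n => 1 - P (ξ n ⁻¹' G)ᶜ) atTop (𝓝 (1 - 0)) :=
        ENNReal.Tendsto.sub tendsto_const_nhds h1 (Or.inl (by simp))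
      rw [tsub_zero] at h2
      have h3 : ∀ n, P.map (ξ n) G = 1 - P (ξ n ⁻¹' G)ᶜ := fun n => by
        rw [Measure.map_apply (hξ n) hG.measurableSet,
          ← prob_compl_eq_one_sub (hξ n hG.measurableSet).compl, compl_compl]
      simp only [h3, h2.liminf_eq]
      exact prob_le_one
    · simp [hm]

/-! ### Vague topology and measurability of the empirical measures -/

/-- Complete regularity is inherited from a product of copies of [0, ∞] by any topology induced from
it, so metrizability of the vague topology plays no role. -/
instance {E : Type*} [TopologicalSpace E] [MeasurableSpace E] :
    CompletelyRegularSpace (RadonMeasure E) :=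
  (IsInducing.induced
    fun (μ : RadonMeasure E) (f : C_c(E, ℝ≥0)) => ∫⁻ x, (f x : ℝ≥0∞) ∂μ.1).completelyRegularSpace

theorem tendsto_radonMeasure_iff {E : Type*} [TopologicalSpace E] [MeasurableSpace E]
    {ι : Type*} {L : Filter ι} {μ : ι → RadonMeasure E} {m : RadonMeasure E} :
    Tendsto μ L (𝓝 m) ↔ ∀ f : C_c(E, ℝ≥0),
      Tendsto (fun a => ∫⁻ x, (f x : ℝ≥0∞) ∂(μ a).1) L (𝓝 (∫⁻ x, (f x : ℝ≥0∞) ∂m.1)) := by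
  rw [(IsInducing.induced
    (fun (μ : RadonMeasure E) (f : C_c(E, ℝ≥0)) => ∫⁻ x, (f x : ℝ≥0∞) ∂μ.1)).tendsto_nhds_iff,
    tendsto_pi_nhds]
  rfl

/-- A random element that depends on the sample through the anti-ranks only is measurable. -/
theorem measurable_of_antiRank {Ω : Type*} [MeasurableSpace Ω] {n d : ℕ}
    {Z : Fin n → Ω → Fin d → ℝ≥0} (hZ : ∀ i, Measurable (Z i)) {β : Type*} [MeasurableSpace β]
    (F : (Fin n → Fin d → ℕ) → β) : Measurable fun ω => F (antiRank fun i => Z i ω) := by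
  -- Arrays of anti-ranks form a countable discrete space, on which every F is measurable.
  refine (measurable_of_countable F).comp ?_
  refine measurable_pi_lambda _ fun i => measurable_pi_lambda _ fun j => ?_
  have h : ∀ i j, Measurable fun ω => Z i ω j := fun i j => (measurable_pi_apply j).comp (hZ i)
  simp only [antiRank, Finset.card_filter]
  exact Finset.measurable_sum _ fun p _ =>
    Measurable.ite (measurableSet_le (h i j) (h p j)) measurable_const measurable_const

theorem measurable_rankEmpirical {Ω : Type*} [MeasurableSpace Ω] {n d : ℕ} (l k : ℕ)
    {Z : Fin n → Ω → Fin d → ℝ≥0} (hZ : ∀ i, Measurable (Z i)) :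
    Measurable fun ω => rankEmpirical l k fun i => Z i ω := by
  let v (r : Fin n → Fin d → ℕ) (i : Fin n) (j : Fin d) : ℝ≥0∞ := 1 / (r i j : ℝ≥0∞)
  exact measurable_of_antiRank (β := RadonMeasure (cone d l)) hZ fun r =>
    ⟨(k : ℝ≥0)⁻¹ • ∑ i, pointMass (cone d l)
      (fun j => v r i j / kthLargest k fun i => kthLargest l (v r i)), inferInstance⟩

theorem measurable_rankPolarEmpirical {Ω : Type*} [MeasurableSpace Ω] {n d : ℕ} (l k : ℕ)
    {Z : Fin n → Ω → Fin d → ℝ≥0} (hZ : ∀ i, Measurable (Z i)) :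
    Measurable fun ω => rankPolarEmpirical l k fun i => Z i ω := by
  let v (r : Fin n → Fin d → ℕ) (i : Fin n) (j : Fin d) : ℝ≥0∞ := 1 / (r i j : ℝ≥0∞)
  exact measurable_of_antiRank (β := RadonMeasure (Ioi (0 : ℝ≥0∞) × deltaAleph d l)) hZ fun r =>
    ⟨(k : ℝ≥0)⁻¹ • ∑ i, (pointMass (Ioi 0)
      (kthLargest l (v r i) / kthLargest k fun i => kthLargest l (v r i))).prod
      (pointMass (deltaAleph d l) (fun j => v r i j / kthLargest l (v r i))), inferInstance⟩

/-! ### Mapping theorem for vague convergence -/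

/-- A continuous cutoff on `[0, ∞]`: equal to `1` on `[0, M]` and to `0` on `[2 M, ∞]`. -/
noncomputable def cutoff (M : ℝ≥0) (t : ℝ≥0∞) : ℝ≥0 := (min 1 (2 - t / M)).toNNReal

theorem continuous_cutoff {M : ℝ≥0} (hM : M ≠ 0) : Continuous (cutoff M) := by
  refine ENNReal.continuousOn_toNNReal.comp_continuous ?_ fun t => ?_
  · exact continuous_const.min ((ENNReal.continuous_sub_left (by simp)).comp
      (ENNReal.continuous_div_const _ (by simpa using hM)))
  · exact ne_top_of_le_ne_top ENNReal.one_ne_top (min_le_left _ _)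

theorem cutoff_le_one (M : ℝ≥0) (t : ℝ≥0∞) : cutoff M t ≤ 1 := by
  rw [cutoff, ← ENNReal.coe_le_coe, ENNReal.coe_toNNReal
    (ne_top_of_le_ne_top ENNReal.one_ne_top (min_le_left _ _))]
  exact min_le_left _ _

theorem cutoff_of_le {M : ℝ≥0} {t : ℝ≥0∞} (h : t ≤ M) : cutoff M t = 1 := by
  have h1 : t / M ≤ 1 := ENNReal.div_le_of_le_mul (by simpa using h)
  have h2 : (1 : ℝ≥0∞) ≤ 2 - t / M := by
    refine ENNReal.le_sub_of_add_le_left (ne_top_of_le_ne_top ENNReal.one_ne_top h1) ?_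
    calc t / M + 1 ≤ 1 + 1 := by gcongr
      _ = 2 := by norm_num
  simp [cutoff, min_eq_left h2]

theorem cutoff_of_ge {M : ℝ≥0} (hM : M ≠ 0) {t : ℝ≥0∞} (h : 2 * (M : ℝ≥0∞) ≤ t) :
    cutoff M t = 0 := by
  have h1 : 2 ≤ t / M := by
    rwa [ENNReal.le_div_iff_mul_le (Or.inl (by simpa using hM)) (Or.inl (by simp))]
  simp [cutoff, tsub_eq_zero_of_le h1]

/-- If `T` is continuous except on the set where a height function `p` with compact upper level
sets is infinite, and `T` preserves heights, then `μ ↦ T_* μ` is vaguely continuous at every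
measure that does not charge infinite height. -/
theorem tendsto_map_of_height {X Y : Type*} [TopologicalSpace X] [MeasurableSpace X]
    [OpensMeasurableSpace X] [TopologicalSpace Y] [MeasurableSpace Y] [OpensMeasurableSpace Y]
    {p : X → ℝ≥0∞} (hp : Continuous p)
    (hpc : ∀ r : ℝ≥0∞, 0 < r → IsCompact {x | r ≤ p x}) {q : Y → ℝ≥0∞} (hq : Continuous q)
    (hq0 : ∀ y, 0 < q y) {T : X → Y} (hT : Measurable T) (hTc : ContinuousOn T {x | p x < ∞})
    (hqT : ∀ x, q (T x) = p x) {ι : Type*} {L : Filter ι} {μ : ι → RadonMeasure X}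
    {ν : RadonMeasure X} {μ' : ι → RadonMeasure Y} {ν' : RadonMeasure Y}
    (hμ : ∀ᶠ a in L, (μ' a).1 = (μ a).1.map T) (hν : ν'.1 = ν.1.map T)
    (hν0 : ν.1 {x | p x = ∞} = 0) (h : Tendsto μ L (𝓝 ν)) : Tendsto μ' L (𝓝 ν') := by
  rw [tendsto_radonMeasure_iff] at h ⊢
  intro g
  have hgm : Measurable fun y => (g y : ℝ≥0∞) :=
    (ENNReal.continuous_coe.comp g.continuous).measurable
  have hgT : Measurable fun x => (g (T x) : ℝ≥0∞) := hgm.comp hT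
  -- The height attains a positive minimum on the compact support of g.
  obtain ⟨r, hr, hrg⟩ : ∃ r : ℝ≥0∞, 0 < r ∧ ∀ y, g y ≠ 0 → r ≤ q y := by
    have hK : IsCompact (tsupport g) := g.hasCompactSupport
    rcases (tsupport g).eq_empty_or_nonempty with he | hne
    · refine ⟨1, one_pos, fun y hy => ?_⟩
      have := subset_tsupport _ (Function.mem_support.2 hy)
      simp [he] at this
    · obtain ⟨y, -, hmin⟩ := hK.exists_isMinOn hne hq.continuousOn
      exact ⟨q y, hq0 y, fun z hz => hmin (subset_tsupport _ (Function.mem_support.2 hz))⟩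
  obtain ⟨C, hC⟩ : ∃ C : ℝ≥0, ∀ y, g y ≤ C := by
    rcases (tsupport g).eq_empty_or_nonempty with he | hne
    · refine ⟨0, fun y => ?_⟩
      rw [image_eq_zero_of_notMem_tsupport (f := g) (by simp [he])]
    · obtain ⟨y, -, hmax⟩ := g.hasCompactSupport.isCompact.exists_isMaxOn hne
        g.continuous.continuousOn
      refine ⟨g y, fun z => ?_⟩
      by_cases hz : z ∈ tsupport g
      · exact hmax hz
      · rw [image_eq_zero_of_notMem_tsupport hz]
        exact zero_le
  have hcm : ∀ M : ℕ, (((M : ℝ≥0) + 1 : ℝ≥0)) ≠ 0 := fun M => by positivity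
  -- truncated test functions on `X`
  have hf : ∀ M : ℕ, ∃ f : C_c(X, ℝ≥0), ∀ x, f x = cutoff (M + 1) (p x) * g (T x) := fun M => by
    refine ⟨⟨⟨fun x => cutoff (M + 1) (p x) * g (T x), ?_⟩, ?_⟩, fun x => rfl⟩
    · rw [continuous_iff_continuousAt]
      intro x
      by_cases hx : p x < ∞
      · have hopen : {x | p x < ∞} ∈ 𝓝 x := (isOpen_lt hp continuous_const).mem_nhds hx
        exact (((continuous_cutoff (hcm M)).comp hp).continuousAt).mul
          (g.continuous.continuousAt.comp (hTc.continuousAt hopen))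
      -- At infinite height T may be discontinuous, but the cutoff vanishes on a whole
      -- neighbourhood.
      · have hx' : p x = ∞ := by simpa using hx
        have hopen : {x | 2 * (((M : ℝ≥0) + 1 : ℝ≥0) : ℝ≥0∞) < p x} ∈ 𝓝 x :=
          (isOpen_lt continuous_const hp).mem_nhds (by
            rw [mem_ofPred_eq, hx']
            exact ENNReal.mul_lt_top (by simp) (by simp))
        refine (continuousAt_const (y := (0 : ℝ≥0))).congr ?_
        filter_upwards [hopen] with z hz
        rw [cutoff_of_ge (hcm M) hz.le, zero_mul]
    · refine HasCompactSupport.intro' (hpc r hr) (isClosed_le continuous_const hp) fun x hx => ?_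
      by_contra hne
      exact hx ((hrg _ (right_ne_zero_of_mul hne)).trans (hqT x).le)
  -- The complementary cutoff lives on {p ≥ M + 1}, which is compact. It is itself a test function,
  -- so the truncation error converges along L as well and no separate tightness is required.
  have hu : ∀ M : ℕ, ∃ u : C_c(X, ℝ≥0), ∀ x, u x = 1 - cutoff (M + 1) (p x) := fun M => by
    refine ⟨⟨⟨fun x => 1 - cutoff (M + 1) (p x), ?_⟩, ?_⟩, fun x => rfl⟩
    · exact continuous_const.sub ((continuous_cutoff (hcm M)).comp hp)
    · refine HasCompactSupport.intro' (hpc ((M + 1 : ℝ≥0) : ℝ≥0)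
        (by simp)) (isClosed_le continuous_const hp) fun x hx => ?_
      rw [mem_ofPred_eq, not_le] at hx
      dsimp only
      rw [cutoff_of_le hx.le, tsub_self]
  choose f hf using hf
  choose u hu using hu
  have hum : ∀ M, Measurable fun x => (u M x : ℝ≥0∞) := fun M =>
    (ENNReal.continuous_coe.comp (u M).continuous).measurable
  have hfm : ∀ M, Measurable fun x => (f M x : ℝ≥0∞) := fun M =>
    (ENNReal.continuous_coe.comp (f M).continuous).measurable
  have hlow : ∀ M (m : Measure X), ∫⁻ x, f M x ∂m ≤ ∫⁻ x, g (T x) ∂m := fun M m => by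
    refine lintegral_mono fun x => ?_
    rw [ENNReal.coe_le_coe, hf]
    exact mul_le_of_le_one_left' (cutoff_le_one _ _)
  have hupp : ∀ M (m : Measure X), ∫⁻ x, g (T x) ∂m ≤ ∫⁻ x, f M x ∂m + C * ∫⁻ x, u M x ∂m :=
    fun M m => by
    rw [← lintegral_const_mul _ (hum M), ← lintegral_add_left (hfm M)]
    refine lintegral_mono fun x => ?_
    rw [← ENNReal.coe_mul, ← ENNReal.coe_add, hf, hu, ENNReal.coe_le_coe]
    calc g (T x) = (cutoff (M + 1) (p x) + (1 - cutoff (M + 1) (p x))) * g (T x) := by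
          rw [add_tsub_cancel_of_le (cutoff_le_one _ _), one_mul]
      _ = cutoff (M + 1) (p x) * g (T x) + (1 - cutoff (M + 1) (p x)) * g (T x) := add_mul _ _ _
      _ ≤ cutoff (M + 1) (p x) * g (T x) + C * (1 - cutoff (M + 1) (p x)) := by
          rw [mul_comm C]
          gcongr
          exact hC _
  -- The integral of `u M` is at most ν{p ≥ M + 1}, which decreases to ν{p = ∞} = 0; compactness of
  -- the first level set supplies the finiteness needed for continuity from above.
  have hu0 : Tendsto (fun M => C * ∫⁻ x, u M x ∂ν.1) atTop (𝓝 0) := by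
    have hlev : Tendsto (fun M : ℕ => ν.1 {x | ((M + 1 : ℝ≥0) : ℝ≥0∞) ≤ p x}) atTop (𝓝 0) := by
      have hinter : ⋂ M : ℕ, {x | ((M + 1 : ℝ≥0) : ℝ≥0∞) ≤ p x} = {x | p x = ∞} := by
        ext x
        simp only [mem_iInter, mem_ofPred_eq]
        refine ⟨fun hx => ENNReal.eq_top_of_forall_nnreal_le fun s => ?_, fun hx M => by simp [hx]⟩
        obtain ⟨N, hN⟩ := exists_nat_ge s
        refine le_trans ?_ (hx N)
        exact_mod_cast hN.trans (by simp)
      rw [← hν0, ← hinter]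
      refine tendsto_measure_iInter_atTop (fun M => ?_) (fun M N hMN x hx => ?_) ⟨0, ?_⟩
      · exact (isClosed_le continuous_const hp).measurableSet.nullMeasurableSet
      · refine le_trans (b := ((N + 1 : ℝ≥0) : ℝ≥0∞)) ?_ hx
        gcongr
      · have := ν.2
        exact (hpc _ (by simp)).measure_lt_top.ne
    have hC0 := ENNReal.Tendsto.const_mul (a := (C : ℝ≥0∞)) hlev (Or.inr (by simp))
    rw [mul_zero] at hC0
    refine tendsto_of_tendsto_of_tendsto_of_le_of_le tendsto_const_nhds hC0 (fun _ => zero_le)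
      fun M => ?_
    dsimp only
    gcongr
    rw [← lintegral_indicator_one (isClosed_le continuous_const hp).measurableSet]
    refine lintegral_mono fun x => ?_
    by_cases hx : ((M + 1 : ℝ≥0) : ℝ≥0∞) ≤ p x
    · rw [indicator_of_mem (show x ∈ {b | ((M + 1 : ℝ≥0) : ℝ≥0∞) ≤ p b} from hx), hu]
      simp
    · rw [indicator_of_notMem (show x ∉ {b | ((M + 1 : ℝ≥0) : ℝ≥0∞) ≤ p b} from hx), hu,
         cutoff_of_le (not_le.1 hx).le]
      simp
  rw [hν, lintegral_map hgm hT]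
  refine Tendsto.congr' (f₁ := fun a => ∫⁻ x, g (T x) ∂(μ a).1) ?_ ?_
  · filter_upwards [hμ] with a ha
    rw [ha, lintegral_map hgm hT]
  set v := ∫⁻ x, (g (T x) : ℝ≥0∞) ∂ν.1
  -- Sandwich f_M ≤ g ∘ T ≤ f_M + C u_M: M is fixed from the limit measure first, then the limit
  -- along L is taken on the outer terms.
  refine tendsto_order.2 ⟨fun b hb => ?_, fun b hb => ?_⟩
  · obtain ⟨M, hM⟩ : ∃ M, b < ∫⁻ x, f M x ∂ν.1 := by
      by_contra! hcon
      have h1 : Tendsto (fun M => b + C * ∫⁻ x, u M x ∂ν.1) atTop (𝓝 (b + 0)) :=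
        hu0.const_add b
      rw [add_zero] at h1
      refine hb.not_ge (ge_of_tendsto' h1 fun M => (hupp M ν.1).trans ?_)
      gcongr
      exact hcon M
    filter_upwards [(h (f M)).eventually (lt_mem_nhds hM)] with a ha
    exact ha.trans_le (hlow M _)
  · obtain ⟨M, hM⟩ : ∃ M, v + C * ∫⁻ x, u M x ∂ν.1 < b := by
      have h1 : Tendsto (fun M => v + C * ∫⁻ x, u M x ∂ν.1) atTop (𝓝 (v + 0)) :=
        hu0.const_add v
      rw [add_zero] at h1
      exact (h1.eventually (gt_mem_nhds hb)).exists
    have h2 : Tendsto (fun a => ∫⁻ x, f M x ∂(μ a).1 + C * ∫⁻ x, u M x ∂(μ a).1) L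
        (𝓝 (∫⁻ x, f M x ∂ν.1 + C * ∫⁻ x, u M x ∂ν.1)) :=
      (h (f M)).add (ENNReal.Tendsto.const_mul (h (u M)) (Or.inr (by simp)))
    have h3 : ∫⁻ x, f M x ∂ν.1 + C * ∫⁻ x, u M x ∂ν.1 < b :=
      lt_of_le_of_lt (by gcongr; exact hlow M _) hM
    filter_upwards [h2.eventually (gt_mem_nhds h3)] with a ha
    exact (hupp M _).trans_lt ha

/-! ### Polar coordinates -/

theorem kthLargest_le_of_forall {n k : ℕ} (hk : 1 ≤ k) {x : Fin n → ℝ≥0∞} {t : ℝ≥0∞}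
    (h : ∀ i, x i ≤ t) : kthLargest k x ≤ t := by
  unfold kthLargest
  refine Finset.sup_le fun s hs => ?_
  obtain ⟨i, hi⟩ : s.Nonempty := Finset.card_pos.1 (by
    rw [(Finset.mem_powersetCard.1 hs).2]; exact hk)
  exact (Finset.inf_le hi).trans (h i)

theorem le_kthLargest_of_forall {n k : ℕ} (hk : k ≤ n) {x : Fin n → ℝ≥0∞} {t : ℝ≥0∞}
    (h : ∀ i, t ≤ x i) : t ≤ kthLargest k x := by
  rw [le_kthLargest_iff hk]
  simpa [h] using hk

/-- Monotone maps commute with finite suprema and infima; c ≠ 0 serves the empty infimum ∞. The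
value c = ∞ is allowed because `ofPolar` accepts an infinite radius. -/
theorem kthLargest_mul {n : ℕ} (k : ℕ) {c : ℝ≥0∞} (hc : c ≠ 0) (x : Fin n → ℝ≥0∞) :
    kthLargest k (fun i => c * x i) = c * kthLargest k x := by
  have hm : Monotone fun t : ℝ≥0∞ => c * t := fun a b h => mul_le_mul_right h _
  unfold kthLargest
  rw [Finset.apply_sup_eq_sup_comp_of_linearOrder _ hm (by simp)]
  refine Finset.sup_congr rfl fun s _ => ?_
  simp only [Function.comp_apply]
  rw [Finset.apply_inf_eq_inf_comp_of_linearOrder _ hm (by simp [hc])]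
  rfl

theorem kthLargest_div {n : ℕ} (k : ℕ) {c : ℝ≥0∞} (hc : c ≠ ∞) (x : Fin n → ℝ≥0∞) :
    kthLargest k (fun i => x i / c) = kthLargest k x / c := by
  simp only [div_eq_mul_inv, mul_comm _ c⁻¹]
  exact kthLargest_mul k (ENNReal.inv_ne_zero.2 hc) x

theorem kthLargest_angle {d l : ℕ} {x : Fin d → ℝ≥0∞} (h0 : kthLargest l x ≠ 0)
    (h1 : kthLargest l x ≠ ∞) : kthLargest l (angle l x) = 1 :=
  (kthLargest_div l h1 x).trans (ENNReal.div_self h0 h1)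

theorem one_mem_deltaAleph {d l : ℕ} (hl : 1 ≤ l) (hld : l ≤ d) :
    (1 : Fin d → ℝ≥0∞) ∈ deltaAleph d l :=
  le_antisymm (kthLargest_le_of_forall hl fun _ => le_rfl)
    (le_kthLargest_of_forall hld fun _ => le_rfl)

theorem isCompact_cone_le (d l : ℕ) {r : ℝ≥0∞} (hr : 0 < r) :
    IsCompact {x : cone d l | r ≤ kthLargest l x.1} := by
  rw [Subtype.isCompact_iff]
  have : (Subtype.val '' {x : cone d l | r ≤ kthLargest l x.1} : Set (Fin d → ℝ≥0∞))
      = {x | r ≤ kthLargest l x} := by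
    ext x
    exact ⟨fun ⟨y, hy, hyx⟩ => hyx ▸ hy, fun hx => ⟨⟨x, hr.trans_le hx⟩, hx, rfl⟩⟩
  rw [this]
  exact (isClosed_le continuous_const (continuous_kthLargest l)).isCompact

theorem isCompact_polar_le (d l : ℕ) {r : ℝ≥0∞} (hr : 0 < r) :
    IsCompact {y : Ioi (0 : ℝ≥0∞) × deltaAleph d l | r ≤ y.1.1} := by
  have h1 : IsCompact {a : Ioi (0 : ℝ≥0∞) | r ≤ a.1} := by
    rw [Subtype.isCompact_iff]
    have : (Subtype.val '' {a : Ioi (0 : ℝ≥0∞) | r ≤ a.1} : Set ℝ≥0∞) = Ici r := by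
      ext x
      exact ⟨fun ⟨y, hy, hyx⟩ => hyx ▸ hy, fun hx => ⟨⟨x, hr.trans_le hx⟩, hx, rfl⟩⟩
    rw [this]
    exact isClosed_Ici.isCompact
  have h2 : CompactSpace (deltaAleph d l) := isCompact_iff_compactSpace.1
    (isClosed_singleton.preimage (continuous_kthLargest l)).isCompact
  convert h1.prod (isCompact_univ (X := deltaAleph d l)) using 1
  ext y
  simp

open Classical in
/-- The angle of `x`, with the value `(1, …, 1)` where it is not defined. -/
noncomputable def totalAngle {d l : ℕ} (hl : 1 ≤ l) (hld : l ≤ d) (x : cone d l) :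
    deltaAleph d l :=
  if h : angle l x.1 ∈ deltaAleph d l then ⟨angle l x.1, h⟩ else ⟨1, one_mem_deltaAleph hl hld⟩

/-- Polar coordinates `x ↦ (x^{(l)}, x / x^{(l)})`. -/
noncomputable def toPolar {d l : ℕ} (hl : 1 ≤ l) (hld : l ≤ d) (x : cone d l) :
    Ioi (0 : ℝ≥0∞) × deltaAleph d l :=
  (⟨kthLargest l x.1, x.2⟩, totalAngle hl hld x)

/-- The inverse `(r, θ) ↦ r θ` of polar coordinates. -/
noncomputable def ofPolar {d l : ℕ} (y : Ioi (0 : ℝ≥0∞) × deltaAleph d l) : cone d l :=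
  ⟨fun j => y.1.1 * y.2.1 j, by
    change 0 < kthLargest l _
    rw [kthLargest_mul l (ne_of_gt y.1.2), show kthLargest l y.2.1 = 1 from y.2.2, mul_one]
    exact y.1.2⟩

variable {d l : ℕ}

theorem kthLargest_ofPolar (y : Ioi (0 : ℝ≥0∞) × deltaAleph d l) :
    kthLargest l (ofPolar y).1 = y.1.1 := by
  unfold ofPolar
  rw [kthLargest_mul l (ne_of_gt y.1.2), show kthLargest l y.2.1 = 1 from y.2.2, mul_one]

theorem totalAngle_of_lt_top (hl : 1 ≤ l) (hld : l ≤ d) {x : cone d l}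
    (hx : kthLargest l x.1 < ∞) : (totalAngle hl hld x).1 = angle l x.1 := by
  have h : angle l x.1 ∈ deltaAleph d l := kthLargest_angle (ne_of_gt x.2) hx.ne
  rw [totalAngle, dif_pos h]

theorem ofPolar_toPolar (hl : 1 ≤ l) (hld : l ≤ d) {x : cone d l}
    (hx : kthLargest l x.1 < ∞) : ofPolar (toPolar hl hld x) = x := by
  refine Subtype.ext (funext fun j => ?_)
  simp only [ofPolar, toPolar, totalAngle_of_lt_top hl hld hx, angle]
  exact ENNReal.mul_div_cancel (ne_of_gt x.2) hx.ne

theorem measurable_toPolar (hl : 1 ≤ l) (hld : l ≤ d) :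
    Measurable (toPolar hl hld : cone d l → _) := by
  have ha : Measurable fun x : cone d l => angle l x.1 :=
    (measurable_angle l).comp measurable_subtype_coe
  refine Measurable.prodMk ?_ ?_
  · exact ((continuous_kthLargest l).measurable.comp measurable_subtype_coe).subtype_mk
  · have h : Measurable fun x : cone d l => (totalAngle hl hld x).1 := by
      classical
      have : (fun x : cone d l => (totalAngle hl hld x).1) =
          fun x => if angle l x.1 ∈ deltaAleph d l then angle l x.1 else 1 := by
        funext x
        unfold totalAngle
        split_ifs <;> rfl
      rw [this]
      exact Measurable.ite (ha (measurableSet_deltaAleph d l)) ha measurable_const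
    exact h.subtype_mk

/-- Division on [0, ∞] is discontinuous only at 0/0 and ∞/∞, and here the denominator is positive
and finite. -/
theorem continuousOn_toPolar (hl : 1 ≤ l) (hld : l ≤ d) :
    ContinuousOn (toPolar hl hld : cone d l → _) {x | kthLargest l x.1 < ∞} := by
  have hk : Continuous fun x : cone d l => kthLargest l x.1 :=
    (continuous_kthLargest l).comp continuous_subtype_val
  refine ContinuousOn.prodMk (hk.subtype_mk _).continuousOn ?_
  rw [IsInducing.subtypeVal.continuousOn_iff]
  refine ContinuousOn.congr (f := fun x : cone d l => angle l x.1) ?_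
    fun x hx => totalAngle_of_lt_top hl hld hx
  refine continuousOn_pi.2 fun j x hx => ContinuousAt.continuousWithinAt ?_
  refine ENNReal.Tendsto.div ?_ (Or.inr (ne_of_gt x.2)) hk.continuousAt (Or.inl (ne_of_lt hx))
  exact ((continuous_apply j).comp continuous_subtype_val).continuousAt

theorem measurable_ofPolar : Measurable (ofPolar : _ → cone d l) := by
  refine Measurable.subtype_mk (measurable_pi_lambda _ fun j => ?_)
  exact (measurable_subtype_coe.comp measurable_fst).mul
    ((measurable_pi_apply j).comp (measurable_subtype_coe.comp measurable_snd))

theorem continuousOn_ofPolar :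
    ContinuousOn (ofPolar : _ → cone d l) {y | y.1.1 < ∞} := by
  rw [IsInducing.subtypeVal.continuousOn_iff]
  refine continuousOn_pi.2 fun j y hy => ContinuousAt.continuousWithinAt ?_
  refine ENNReal.Tendsto.mul ?_ (Or.inl (ne_of_gt y.1.2)) ?_ (Or.inr (ne_of_lt hy))
  · exact (continuous_subtype_val.comp continuous_fst).continuousAt
  · exact ((continuous_apply j).comp (continuous_subtype_val.comp continuous_snd)).continuousAt

/-- Only this composite is needed, since the measures on the polar side are already images under
`toPolar`. -/
theorem map_ofPolar_map_toPolar (hl : 1 ≤ l) (hld : l ≤ d) {μ : Measure (cone d l)}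
    (hμ : μ {x | kthLargest l x.1 = ∞} = 0) : (μ.map (toPolar hl hld)).map ofPolar = μ := by
  rw [Measure.map_map measurable_ofPolar (measurable_toPolar hl hld)]
  conv_rhs => rw [← Measure.map_id (μ := μ)]
  refine Measure.map_congr ?_
  have h : ∀ᵐ x ∂μ, ¬ kthLargest l x.1 = ∞ := by
    rw [ae_iff]; simpa using hμ
  filter_upwards [h] with x hx
  exact ofPolar_toPolar hl hld (lt_top_iff_ne_top.2 hx)

/-! ### The limit measure in polar coordinates -/

/-- The set is invariant under doubling and contained in the compact set `aleph d l`, so its finite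
mass equals 2^{-α} times itself and must vanish. -/
theorem Scaling.measure_top {α : ℝ} (hα : 0 < α) {ν : RadonMeasure (cone d l)}
    (h : Scaling α ν.1) : ν.1 {x | kthLargest l x.1 = ∞} = 0 := by
  have h1 := h 2 two_pos {x | kthLargest l x = ∞}
    ((continuous_kthLargest l).measurable (measurableSet_singleton ∞))
  have himg : (fun a : Fin d → ℝ≥0∞ => (2 : ℝ≥0) • a) '' {x | kthLargest l x = ∞}
      = {x | kthLargest l x = ∞} := by
    ext x
    constructor
    · rintro ⟨a, ha, rfl⟩
      rw [mem_ofPred_eq] at ha ⊢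
      rw [kthLargest_smul l two_pos, ha]
      exact ENNReal.mul_top (by simp)
    · intro hx
      refine ⟨(2 : ℝ≥0)⁻¹ • x, ?_, ?_⟩
      · rw [mem_ofPred_eq] at hx ⊢
        rw [kthLargest_smul l (by positivity), hx]
        exact ENNReal.mul_top (by simp)
      · simp only [smul_smul]
        rw [mul_inv_cancel₀ two_ne_zero, one_smul]
  rw [himg] at h1
  have hfin : ν.1 {x | kthLargest l x.1 = ∞} ≠ ∞ := by
    have := ν.2
    refine ne_top_of_le_ne_top (isCompact_aleph d l).measure_lt_top.ne (measure_mono fun x hx => ?_)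
    rw [mem_ofPred_eq] at hx
    simp [aleph, hx]
  simp only [mem_ofPred_eq] at h1
  by_contra h0
  have h2 : ((2 : ℝ≥0) : ℝ≥0∞) ^ (-α) < 1 :=
    ENNReal.rpow_lt_one_of_one_lt_of_neg (by norm_num) (by linarith)
  have h3 := (ENNReal.mul_lt_mul_iff_left h0 hfin).2 h2
  rw [one_mul, ← h1] at h3
  exact lt_irrefl _ h3

theorem pareto_top (α : ℝ) : pareto α {x | x.1 = ∞} = 0 := by
  have himg : (Subtype.val '' {x : Ioi (0 : ℝ≥0∞) | x.1 = ∞} : Set ℝ≥0∞) ⊆ {∞} := by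
    rintro _ ⟨y, hy, rfl⟩
    exact hy
  rw [pareto, comap_subtype_coe_apply measurableSet_Ioi]
  refine measure_mono_null himg ?_
  rw [Measure.map_apply ENNReal.measurable_ofReal (measurableSet_singleton _)]
  have hpre : ENNReal.ofReal ⁻¹' {∞} = ∅ := by
    ext x
    simp
  rw [hpre, measure_empty]

/-- The polar decomposition of `ν` as a product measure. -/
theorem polarLimit_eq_map (hl : 1 ≤ l) (hld : l ≤ d) {α : ℝ} (hα : 0 < α)
    {ν : RadonMeasure (cone d l)} (h : Scaling α ν.1) :
    (polarLimit hα ν).1 = ν.1.map (toPolar hl hld) := by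
  have := isFiniteMeasure_angularMeasure ν
  have hfin : ∀ n : ℕ, ENNReal.ofReal ((n : ℝ) + 1)⁻¹ ∈ Ioi 0 := fun n =>
    ENNReal.ofReal_pos.2 (by positivity)
  have hspan : (pareto α).FiniteSpanningSetsIn (range Ici) :=
    { set := fun n => Ici ⟨ENNReal.ofReal ((n : ℝ) + 1)⁻¹, hfin n⟩
      set_mem := fun n => mem_range_self _
      finite := fun n => by
        refine lt_of_le_of_lt (le_of_eq (pareto_Ici hα (r := ((n : ℝ) + 1)⁻¹) (by positivity))) ?_
        exact ENNReal.ofReal_lt_top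
      spanning := by
        refine eq_univ_of_forall fun x => mem_iUnion.2 ?_
        obtain ⟨r, hr0, hr⟩ := ENNReal.lt_iff_exists_nnreal_btwn.1 (show 0 < x.1 from x.2)
        obtain ⟨n, hn⟩ := exists_nat_one_div_lt (show (0 : ℝ) < r by simpa using hr0)
        refine ⟨n, ?_⟩
        change ENNReal.ofReal _ ≤ x.1
        refine le_trans ?_ hr.le
        rw [← ENNReal.ofReal_coe_nnreal]
        rw [one_div] at hn
        exact ENNReal.ofReal_le_ofReal hn.le }
  -- Uniqueness on the π-system of sets [r, ∞] × Λ, where `Scaling.polar` and `pareto_Ici` give both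
  -- sides; the rays [1/(n+1), ∞] have finite Pareto mass and exhaust (0, ∞].
  refine Measure.prod_eq_generateFrom (C := range Ici) (D := {s | MeasurableSet s})
    ?_ MeasurableSpace.generateFrom_measurableSet ?_ MeasurableSpace.isPiSystem_measurableSet hspan
    (Measure.toFiniteSpanningSetsIn _) ?_
  · rw [← borel_eq_generateFrom_Ici]
    exact BorelSpace.measurable_eq.symm
  · rintro _ ⟨a, rfl⟩ _ ⟨b, rfl⟩ -
    exact ⟨a ⊔ b, Ici_inter_Ici.symm⟩
  rintro _ ⟨r, rfl⟩ Λ hΛ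
  rw [Measure.map_apply (measurable_toPolar hl hld) (measurableSet_Ici.prod hΛ)]
  have hae : ν.1 (toPolar hl hld ⁻¹' (Ici r ×ˢ Λ)) =
      ν.1 {x | r.1 ≤ kthLargest l x.1 ∧ angle l x.1 ∈ Subtype.val '' Λ} := by
    have h0 : ∀ᵐ x ∂ν.1, ¬ kthLargest l x.1 = ∞ := by
      rw [ae_iff]; simpa using h.measure_top hα
    refine measure_congr ?_
    filter_upwards [h0] with x hx
    refine propext (and_congr Iff.rfl ?_)
    rw [← totalAngle_of_lt_top hl hld (lt_top_iff_ne_top.2 hx), Subtype.val_injective.mem_set_image]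
    rfl
  rw [hae]
  -- The polar formula covers finite r only; at r = ∞ both sides are zero.
  rcases eq_or_ne r.1 ∞ with hr | hr
  · have h1 : pareto α (Ici r) = 0 := measure_mono_null (fun x hx => ?_) (pareto_top α)
    · rw [h1, zero_mul]
      refine measure_mono_null (fun x hx => ?_) (h.measure_top hα)
      have := hx.1
      rw [hr] at this
      exact top_le_iff.1 this
    · have : r.1 ≤ x.1 := hx
      rw [hr] at this
      exact top_le_iff.1 this
  · have hr0 : 0 < r.1.toNNReal := ENNReal.toNNReal_pos (ne_of_gt r.2) hr
    have h1 := h.polar hr0 hΛ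
    have h2 := pareto_Ici hα (r := r.1.toNNReal) (by exact_mod_cast hr0)
    rw [ENNReal.ofReal_coe_nnreal, ENNReal.coe_toNNReal hr] at h2
    rw [ENNReal.coe_toNNReal hr] at h1
    rw [h1]
    congr 1
    refine Eq.symm (h2.trans ?_)
    rw [← ENNReal.ofReal_rpow_of_pos (by exact_mod_cast hr0), ENNReal.ofReal_coe_nnreal,
      ENNReal.coe_toNNReal hr]

/-! ### Polar coordinates of the empirical measures -/

/-- Each vector counts itself, so an anti-rank is at least 1, even with ties. -/
theorem invRank_mem {n : ℕ} (z : Fin n → Fin d → ℝ≥0) (i : Fin n) (j : Fin d) :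
    (n : ℝ≥0∞)⁻¹ ≤ invRank z i j ∧ invRank z i j ≤ 1 := by
  have h1 : 1 ≤ antiRank z i j := Finset.card_pos.2 ⟨i, by simp⟩
  have h2 : antiRank z i j ≤ n := by
    simpa [antiRank] using Finset.card_filter_le (Finset.univ : Finset (Fin n)) _
  rw [invRank, one_div]
  exact ⟨ENNReal.inv_le_inv.2 (by exact_mod_cast h2), ENNReal.inv_le_one.2 (by exact_mod_cast h1)⟩

theorem rankMax_mem (hl : 1 ≤ l) (hld : l ≤ d) {n : ℕ} (z : Fin n → Fin d → ℝ≥0) (i : Fin n) :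
    (n : ℝ≥0∞)⁻¹ ≤ rankMax l z i ∧ rankMax l z i ≤ 1 :=
  ⟨le_kthLargest_of_forall hld fun j => (invRank_mem z i j).1,
    kthLargest_le_of_forall hl fun j => (invRank_mem z i j).2⟩

theorem rankMaxOrd_mem (hl : 1 ≤ l) (hld : l ≤ d) {n k : ℕ} (hk : 1 ≤ k) (hkn : k ≤ n)
    (z : Fin n → Fin d → ℝ≥0) : (n : ℝ≥0∞)⁻¹ ≤ rankMaxOrd l k z ∧ rankMaxOrd l k z ≤ 1 :=
  ⟨le_kthLargest_of_forall hkn fun i => (rankMax_mem hl hld z i).1,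
    kthLargest_le_of_forall hk fun i => (rankMax_mem hl hld z i).2⟩

theorem ne_zero_and_ne_top_of_inv_le {n : ℕ} {a : ℝ≥0∞} (h : (n : ℝ≥0∞)⁻¹ ≤ a ∧ a ≤ 1) :
    a ≠ 0 ∧ a ≠ ∞ :=
  ⟨ne_of_gt (lt_of_lt_of_le (by simp) h.1), ne_top_of_le_ne_top ENNReal.one_ne_top h.2⟩

theorem pointMass_of_mem {X : Type*} [MeasurableSpace X] {s : Set X} {x : X} (h : x ∈ s) :
    pointMass s x = Measure.dirac ⟨x, h⟩ := by
  rw [pointMass, dif_pos h]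

/-- Atom by atom: normalizing by m_{(k)}^{(l)} rescales the height and cancels in the angle. All
atoms lie in the prescribed subsets, so `pointMass` never takes its default value 0. -/
theorem rankPolarEmpirical_eq_map (hl : 1 ≤ l) (hld : l ≤ d) {n k : ℕ} (hk : 1 ≤ k) (hkn : k ≤ n)
    (z : Fin n → Fin d → ℝ≥0) :
    (rankPolarEmpirical l k z).1 = (rankEmpirical l k z).1.map (toPolar hl hld) := by
  obtain ⟨hM0, hM⟩ := ne_zero_and_ne_top_of_inv_le (rankMaxOrd_mem hl hld hk hkn z)
  unfold rankPolarEmpirical rankEmpirical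
  rw [Measure.map_smul, Measure.map_finset_sum (measurable_toPolar hl hld).aemeasurable]
  refine congrArg ((k : ℝ≥0)⁻¹ • ·) (Finset.sum_congr rfl fun i _ => ?_)
  obtain ⟨hm0, hm⟩ := ne_zero_and_ne_top_of_inv_le (rankMax_mem hl hld z i)
  have hkl : kthLargest l (fun j => invRank z i j / rankMaxOrd l k z) =
    rankMax l z i / rankMaxOrd l k z := kthLargest_div l hM _
  have h0 : rankMax l z i / rankMaxOrd l k z ≠ 0 := by simp [hm0, hM]
  have ht : rankMax l z i / rankMaxOrd l k z ≠ ∞ := ENNReal.div_ne_top hm hM0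
  have hx : (fun j => invRank z i j / rankMaxOrd l k z) ∈ cone d l := by
    change 0 < kthLargest l _
    rw [hkl]
    exact pos_iff_ne_zero.2 h0
  have hr : rankMax l z i / rankMaxOrd l k z ∈ Ioi 0 := pos_iff_ne_zero.2 h0
  have hθ : (fun j => invRank z i j / rankMax l z i) ∈ deltaAleph d l :=
    kthLargest_angle (x := invRank z i) hm0 hm
  rw [pointMass_of_mem hx, pointMass_of_mem hr, pointMass_of_mem hθ, Measure.dirac_prod_dirac]
  refine Eq.trans ?_ (Measure.map_dirac' (measurable_toPolar hl hld) _).symm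
  congr 1
  refine Prod.ext (Subtype.ext hkl.symm) (Subtype.ext ?_)
  rw [toPolar, totalAngle_of_lt_top]
  · funext j
    simp only [angle, hkl]
    rw [div_eq_mul_inv (invRank z i j) (rankMaxOrd l k z),
      div_eq_mul_inv (rankMax l z i) (rankMaxOrd l k z),
      ENNReal.mul_div_mul_right _ _ (ENNReal.inv_ne_zero.2 hM) (ENNReal.inv_ne_top.2 hM0)]
  · rw [hkl]
    exact lt_top_iff_ne_top.2 ht

theorem rankEmpirical_top (hl : 1 ≤ l) (hld : l ≤ d) {n k : ℕ} (hk : 1 ≤ k) (hkn : k ≤ n)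
    (z : Fin n → Fin d → ℝ≥0) : (rankEmpirical l k z).1 {x | kthLargest l x.1 = ∞} = 0 := by
  obtain ⟨hM0, hM⟩ := ne_zero_and_ne_top_of_inv_le (rankMaxOrd_mem hl hld hk hkn z)
  have hmeas : MeasurableSet {x : cone d l | kthLargest l x.1 = ∞} :=
    ((continuous_kthLargest l).measurable.comp measurable_subtype_coe) (measurableSet_singleton ∞)
  unfold rankEmpirical
  rw [Measure.smul_apply, Measure.finsetSum_apply, Finset.sum_eq_zero, smul_zero]
  intro i _
  unfold pointMass
  split_ifs with hx
  · rw [Measure.dirac_apply' _ hmeas, indicator_of_notMem]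
    change ¬ kthLargest l (fun j => invRank z i j / rankMaxOrd l k z) = ∞
    rw [kthLargest_div l hM]
    exact ENNReal.div_ne_top (ne_zero_and_ne_top_of_inv_le (rankMax_mem hl hld z i)).2 hM0
  · rfl

end HRV

theorem proposition3 {d l : ℕ} (hl : 1 ≤ l) (hld : l ≤ d)
    -- the limit measure, its index and its normalization
    {α : ℝ} (hα : 0 < α) (ν : HRV.RadonMeasure (HRV.cone d l))
    (hscal : HRV.Scaling α ν.1) (hnorm : ν.1 (HRV.aleph d l) = 1)
    -- the random vectors
    {Ω : Type*} [MeasurableSpace Ω] (P : Measure Ω) [IsProbabilityMeasure P]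
    (Z : ℕ → Ω → Fin d → ℝ≥0) (hZ : ∀ i, Measurable (Z i))
    -- the number of upper order statistics
    (k : ℕ → ℕ) (hk : Tendsto k atTop atTop)
    (hkn : Tendsto (fun n => (k n : ℝ) / n) atTop (𝓝 0)) :
    HRV.WeakTendsto P
        (fun n ω => HRV.rankEmpirical l (k n) (fun i : Fin n => Z i ω)) ν ↔
      HRV.WeakTendsto P
        (fun n ω => HRV.rankPolarEmpirical l (k n) (fun i : Fin n => Z i ω))
        (HRV.polarLimit hα ν) := by
  -- The order statistic m_{(k)}^{(l)} is meaningful only in this range; the finitely many other n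
  -- are discarded.
  have hev : ∀ᶠ n in atTop, 1 ≤ k n ∧ k n ≤ n := by
    filter_upwards [hk.eventually_ge_atTop 1, hkn.eventually (gt_mem_nhds one_pos),
      eventually_gt_atTop 0] with n h1 h2 h3
    rw [div_lt_one (by exact_mod_cast h3)] at h2
    exact ⟨h1, by exact_mod_cast h2.le⟩
  have htop := hscal.measure_top hα
  have hlim := HRV.polarLimit_eq_map hl hld hα hscal
  have hp : Continuous fun x : HRV.cone d l => HRV.kthLargest l x.1 :=
    (HRV.continuous_kthLargest l).comp continuous_subtype_val
  have hq : Continuous fun y : Ioi (0 : ℝ≥0∞) × HRV.deltaAleph d l => y.1.1 :=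
    continuous_subtype_val.comp continuous_fst
  unfold HRV.WeakTendsto
  rw [HRV.tendstoInDistribution_const_iff P
      (fun n => HRV.measurable_rankEmpirical l (k n) fun i => hZ i),
    HRV.tendstoInDistribution_const_iff P
      (fun n => HRV.measurable_rankPolarEmpirical l (k n) fun i => hZ i)]
  constructor
  · refine HRV.tendsto_map_of_height hp (fun r => HRV.isCompact_cone_le d l) hq
      (fun y => y.1.2) (HRV.measurable_toPolar hl hld) (HRV.continuousOn_toPolar hl hld)
      (fun x => rfl) ?_ hlim htop
    exact HRV.eventually_inProbability_of_forall (hev.mono fun n hn ω =>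
      HRV.rankPolarEmpirical_eq_map hl hld hn.1 hn.2 _)
  -- Converse by the same mapping theorem with T = `ofPolar`. Neither the empirical measures nor ν
  -- charge infinite height, so `ofPolar` recovers them from their polar images.
  · refine HRV.tendsto_map_of_height hq (fun r => HRV.isCompact_polar_le d l) hp
      (fun x => x.2) HRV.measurable_ofPolar HRV.continuousOn_ofPolar
      HRV.kthLargest_ofPolar ?_ ?_ ?_
    · refine HRV.eventually_inProbability_of_forall (hev.mono fun n hn ω => ?_)
      rw [HRV.rankPolarEmpirical_eq_map hl hld hn.1 hn.2, HRV.map_ofPolar_map_toPolar]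
      exact HRV.rankEmpirical_top hl hld hn.1 hn.2 _
    · rw [hlim, HRV.map_ofPolar_map_toPolar hl hld htop]
    · rw [hlim]
      exact (Measure.map_apply (HRV.measurable_toPolar hl hld)
        (hq.measurable (measurableSet_singleton ∞))).trans htop
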